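/- Let $\mathcal D(X)$ be the set of finitely supported probability distributions on a set $X$, let $\delta_x$ be the Dirac distribution, and let $cc$ denote convex closure. Let $\mathcal C(X)$ be the set of nonempty finitely generated convex subsets of $\mathcal D(X)$; it is a functor by direct image under pushforward. Write $1=\{\star\}$. A set $S\in\mathcal C(X+1)$ is $\bot$-closed if, with $\varphi$, it contains every $\psi\in\mathcal D(X+1)$ such that $\psi(x)\le\varphi(x)$ for all $x\in X$. Let $\mathcal C^{\downarrow}(X)\subseteq\mathcal C(X+1)$ be the subset of $\bot$-closed sets. Consider the signature with a constant $\star$, a binary operation $\oplus$ and binary operations $+_p$ for $p\in(0,1)$. The theory $\mathrm{ET}_{CS}^{\star}$ has the axioms $$x\oplus(y\oplus z)=(x\oplus y)\oplus z,\quad x\oplus y=y\oplus x,\quad x\oplus x=x,$$ $$(x+_q y)+_p z=x+_{pq}(y+_{\frac{p(1-q)}{1-pq}}z),\quad x+_p y=y+_{1-p}x,\quad x+_p x=x,$$ $$x+_p(y\oplus z)=(x+_p y)\oplus(x+_p z)$$ for all $p,q\in(0,1)$. The theory $\mathrm{ET}_{CS}^{\bot}$ adds $x\oplus\star=x$, and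 $\mathrm{ET}_{CS}^{\bot,BH}$ adds both $x\oplus\star=x$ and $x+_p\star=\star$ for all $p\in(0,1)$. To these theories correspond monads $M$ as follows. * $\mathrm{ET}_{CS}^{\star}$ corresponds to $M=\mathcal C(\cdot+1)$, with unit $x\mapsto\{\delta_x\}$. The operations on $M(X)$ are convex union $S\oplus T=cc(S\cup T)$, weighted Minkowski sum $S+_pT=\{p\varphi+(1-p)\psi\mid\varphi\in S,\psi\in T\}$, and $\star=\{\delta_\star\}$. * $\mathrm{ET}_{CS}^{\bot,BH}$ corresponds to $M=\mathcal C+1$, with unit $x\mapsto\{\delta_x\}$. The operations are convex union and weighted Minkowski sum on $\mathcal C(X)$; the added element $\star$ is neutral for $\oplus$ and absorbing for every $+_p$. * $\mathrm{ET}_{CS}^{\bot}$ corresponds to $M=\mathcal C^{\downarrow}$, with unit $x\mapsto cc\{\delta_x,\delta_\star\}$ and the operations inherited from $\mathcal C(X+1)$. For each such $\mathtt{Th}$ and $M$, let $\sigma_X$ be the homomorphism from terms over $X$ modulo $\mathtt{Th}$ to $M(X)$ that extends the unit. Let $A$ be a set of actions. The set $Proc$ of process terms is given by $$P::=\mathbf{nil}\mid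 a.P\mid P\mathbin{\overline\oplus}P\mid P\mathbin{\overline{+}_p}P\qquad(a\in A,\ p\in(0,1)).$$ The transition function $\tau$ from $Proc$ to terms over $Proc$ is defined by $$\tau(\mathbf{nil})=\star,\quad \tau(a.P)=P,\quad \tau(P\mathbin{\overline\oplus}Q)=\tau(P)\oplus\tau(Q),\quad \tau(P\mathbin{\overline{+}_p}Q)=\tau(P)+_p\tau(Q).$$ Actions are not recorded by $\tau$, so with one action this is the unlabelled language. Process terms form an $M$-coalgebra via $\tau_M(P)=\sigma_{Proc}([\tau(P)]_{/\mathtt{Th}})$. * *Proof system.* Let $\overset{\mathtt{Th}}{\sim}$ be the smallest relation on $Proc$ closed under the following rule: if all pairs in a relation $R$ have been derived, and $\tau(P)=\tau(Q)$ is derivable in equational logic from the axioms of $\mathtt{Th}$ and the equations $P'=Q'$ for $(P',Q')\in R$ (elements of $Proc$ are treated as constants), then $P\overset{\mathtt{Th}}{\sim}Q$. * *Behavioural equivalence.* An equivalence relation $R$ on $Proc$, with quotient map $q_R:Proc\to Proc/R$, is a behavioural equivalence for $M$ if $M(q_R)(\tau_M(P))=M(q_R)(\tau_M(Q))$ whenever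 $P\mathrel R Q$. Write $P\simeq_M Q$ if some behavioural equivalence for $M$ relates $P$ and $Q$. **Theorem.** For each pair $(\mathtt{Th},M)$ among $(\mathrm{ET}_{CS}^{\star},\mathcal C(\cdot+1))$, $(\mathrm{ET}_{CS}^{\bot,BH},\mathcal C+1)$ and $(\mathrm{ET}_{CS}^{\bot},\mathcal C^{\downarrow})$, and for all $P,Q\in Proc$, $$P\overset{\mathtt{Th}}{\sim}Q\iff P\simeq_M Q .$$ -/

import Mathlib

open CategoryTheory Convexity

universe u v

namespace NDProb

/-! ### Terms, equational theories, equational logic -/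

/-- Probabilities in the open interval `(0,1)`. -/
abbrev Prob : Type := Set.Ioo (0 : ℝ) 1

/-- `1 - p` -/
def Prob.compl (p : Prob) : Prob :=
  ⟨1 - p.1, by have := p.2.2; linarith, by have := p.2.1; linarith⟩

/-- `p * q` -/
def Prob.mul (p q : Prob) : Prob :=
  ⟨p.1 * q.1, mul_pos p.2.1 q.2.1, by have := p.2; have := q.2; nlinarith [p.2.1, q.2.2, p.2.2]⟩

/-- `p * (1 - q) / (1 - p * q)` -/
noncomputable def Prob.skew (p q : Prob) : Prob :=
  ⟨p.1 * (1 - q.1) / (1 - p.1 * q.1), by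
    have h1 := (Prob.mul p q).2.2
    have h2 := mul_pos p.2.1 (Prob.compl q).2.1
    simp only [Prob.mul, Prob.compl] at h1 h2
    refine ⟨div_pos h2 (by linarith), ?_⟩
    rw [div_lt_one (by linarith)]
    nlinarith [p.2.2]⟩

/-- Terms over the signature with a constant `⋆`, a binary operation `⊕`
and binary operations `+_p` for `p ∈ (0,1)`, with generators in `X`. -/
inductive Term (X : Type u) : Type u
  | var (x : X) : Term X
  | star : Term X
  | oplus (s t : Term X) : Term X
  | pplus (p : Prob) (s t : Term X) : Term X

/-- Simultaneous substitution of terms for generators. -/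
def Term.subst {X : Type u} {Y : Type v} (θ : X → Term Y) : Term X → Term Y
  | .var x => θ x
  | .star => .star
  | .oplus s t => .oplus (s.subst θ) (t.subst θ)
  | .pplus p s t => .pplus p (s.subst θ) (t.subst θ)

/-- A set of equations, between terms over the variables `0, 1, 2, …`. -/
abbrev Equations : Type := Set (Term ℕ × Term ℕ)

section Theories

open Term

/-- The axioms of (pointed) convex semilattices. -/
inductive CSAxiom : Term ℕ × Term ℕ → Prop
  | A : CSAxiom (oplus (var 0) (oplus (var 1) (var 2)), oplus (oplus (var 0) (var 1)) (var 2))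
  | C : CSAxiom (oplus (var 0) (var 1), oplus (var 1) (var 0))
  | I : CSAxiom (oplus (var 0) (var 0), var 0)
  | Ap (p q : Prob) : CSAxiom (pplus p (pplus q (var 0) (var 1)) (var 2),
      pplus (p.mul q) (var 0) (pplus (p.skew q) (var 1) (var 2)))
  | Cp (p : Prob) : CSAxiom (pplus p (var 0) (var 1), pplus p.compl (var 1) (var 0))
  | Ip (p : Prob) : CSAxiom (pplus p (var 0) (var 0), var 0)
  | D (p : Prob) : CSAxiom (pplus p (var 0) (oplus (var 1) (var 2)),
      oplus (pplus p (var 0) (var 1)) (pplus p (var 0) (var 2)))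

/-- The theory of pointed convex semilattices. -/
def pointedCS : Equations := {e | CSAxiom e}

/-- The bottom axiom `x ⊕ ⋆ = x`. -/
def bottomEq : Equations := {(oplus (var 0) star, var 0)}

/-- The black-hole axioms `x +_p ⋆ = ⋆`. -/
def blackHoleEq : Equations := Set.range fun p : Prob => (pplus p (var 0) star, star)

/-- The theory of convex semilattices with bottom. -/
def bottomCS : Equations := pointedCS ∪ bottomEq

/-- The theory of convex semilattices with bottom and black hole. -/
def bottomBlackHoleCS : Equations := pointedCS ∪ bottomEq ∪ blackHoleEq

end Theories

/-- Derivability in equational logic of an equation between terms over the generators `X`, from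
the equations of `E`, whose variables may be instantiated by arbitrary terms, together with the
equations `x = y` for `R x y`, in which the generators `x`, `y` are constants. -/
inductive Derivable (E : Equations) {X : Type u} (R : X → X → Prop) : Term X → Term X → Prop
  | ax {e : Term ℕ × Term ℕ} (he : e ∈ E) (θ : ℕ → Term X) :
      Derivable E R (e.1.subst θ) (e.2.subst θ)
  | hyp {x y : X} (h : R x y) : Derivable E R (.var x) (.var y)
  | refl (t : Term X) : Derivable E R t t
  | symm {s t : Term X} : Derivable E R s t → Derivable E R t s
  | trans {s t r : Term X} : Derivable E R s t → Derivable E R t r → Derivable E R s r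
  | oplus {s s' t t' : Term X} : Derivable E R s s' → Derivable E R t t' →
      Derivable E R (.oplus s t) (.oplus s' t')
  | pplus (p : Prob) {s s' t t' : Term X} : Derivable E R s s' → Derivable E R t t' →
      Derivable E R (.pplus p s t) (.pplus p s' t')

/-- Provable equality in the theory `E` of terms over `X`. -/
def termSetoid (E : Equations) (X : Type u) : Setoid (Term X) where
  r := Derivable E fun _ _ => False
  iseqv := ⟨.refl, .symm, .trans⟩

/-- Terms over `X` modulo provable equality in the theory `E`. -/
def TermMod (E : Equations) (X : Type u) : Type u := Quotient (termSetoid E X)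

/-- An algebra for the signature, with carrier `α`. -/
structure Alg (α : Type u) where
  star : α
  oplus : α → α → α
  pplus : Prob → α → α → α

/-- The interpretation of terms in an algebra. -/
def Term.eval {X : Type u} {α : Type v} (𝔸 : Alg α) (η : X → α) : Term X → α
  | .var x => η x
  | .star => 𝔸.star
  | .oplus s t => 𝔸.oplus (s.eval 𝔸 η) (t.eval 𝔸 η)
  | .pplus p s t => 𝔸.pplus p (s.eval 𝔸 η) (t.eval 𝔸 η)

/-- The algebra satisfies the equations of `E`. -/
def Alg.Models {α : Type v} (𝔸 : Alg α) (E : Equations) : Prop :=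
  ∀ e ∈ E, ∀ θ : ℕ → α, e.1.eval 𝔸 θ = e.2.eval 𝔸 θ

theorem Term.eval_subst {X : Type u} {Y : Type*} {α : Type v} (𝔸 : Alg α) (η : Y → α)
    (θ : X → Term Y) (t : Term X) :
    (t.subst θ).eval 𝔸 η = t.eval 𝔸 fun x => (θ x).eval 𝔸 η := by
  induction t with
  | var x => rfl
  | star => rfl
  | oplus s t hs ht => simp [Term.subst, Term.eval, hs, ht]
  | pplus p s t hs ht => simp [Term.subst, Term.eval, hs, ht]

theorem Derivable.eval_eq {E : Equations} {X : Type u} {R : X → X → Prop} {α : Type v}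
    {𝔸 : Alg α} (h : 𝔸.Models E) {η : X → α} (hη : ∀ x y, R x y → η x = η y) {s t : Term X}
    (d : Derivable E R s t) : s.eval 𝔸 η = t.eval 𝔸 η := by
  induction d with
  | ax he θ => rw [Term.eval_subst, Term.eval_subst]; exact h _ he _
  | hyp h => exact hη _ _ h
  | refl => rfl
  | symm _ ih => exact ih.symm
  | trans _ _ ih ih' => exact ih.trans ih'
  | oplus _ _ ih ih' => simp [Term.eval, ih, ih']
  | pplus p _ _ ih ih' => simp [Term.eval, ih, ih']

/-- The homomorphism from terms modulo `E` to a model of `E` that extends `η`. -/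
def TermMod.lift {E : Equations} {X : Type u} {α : Type v} {𝔸 : Alg α} (h : 𝔸.Models E)
    (η : X → α) : TermMod E X → α :=
  Quotient.lift (Term.eval 𝔸 η) fun _ _ d => Derivable.eval_eq h (fun _ _ h => h.elim) d

/-! ### Finitely generated convex sets of distributions

`StdSimplex ℝ X` is the set of finitely supported probability distributions on `X`. -/

/-- Nonempty finitely generated convex sets of finitely supported distributions on `X`. -/
@[ext]
structure ConvSet (X : Type u) : Type u where
  carrier : Set (StdSimplex ℝ X)
  nonempty : carrier.Nonempty
  finitelyGenerated : ∃ B : Set (StdSimplex ℝ X), B.Finite ∧ carrier = Convexity.convexHull ℝ B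

namespace ConvSet

variable {X : Type u} {Y : Type u}

theorem convex (S : ConvSet X) : IsConvexSet ℝ S.carrier := by
  obtain ⟨B, -, h⟩ := S.finitelyGenerated
  rw [h]
  exact .convexHull

/-- The convex closure `cc B` of a nonempty finite set `B` of distributions. -/
def cc (B : Set (StdSimplex ℝ X)) (hB : B.Finite) (hne : B.Nonempty) : ConvSet X where
  carrier := Convexity.convexHull ℝ B
  nonempty := hne.convexHull'
  finitelyGenerated := ⟨B, hB, rfl⟩

/-- `{δ_x}` -/
noncomputable def dirac (x : X) : ConvSet X where
  carrier := {StdSimplex.single x}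
  nonempty := Set.singleton_nonempty _
  finitelyGenerated := ⟨{StdSimplex.single x}, Set.finite_singleton _, by simp⟩

/-- Direct image under the pushforward of distributions along `f`. -/
noncomputable def map (f : X → Y) (S : ConvSet X) : ConvSet Y where
  carrier := StdSimplex.map f '' S.carrier
  nonempty := S.nonempty.image _
  finitelyGenerated := by
    obtain ⟨B, hB, h⟩ := S.finitelyGenerated
    exact ⟨_, hB.image _, by rw [h, (StdSimplex.isAffineMap_map ℝ f).image_convexHull]⟩

@[simp] theorem map_id (S : ConvSet X) : S.map id = S := by
  ext φ; simp [map]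

theorem map_map {Z : Type u} (f : X → Y) (g : Y → Z) (S : ConvSet X) :
    (S.map f).map g = S.map (g ∘ f) := by
  ext φ; simp [map, StdSimplex.map_comp]

/-- Convex union `cc (S ∪ T)`. -/
def union (S T : ConvSet X) : ConvSet X where
  carrier := Convexity.convexHull ℝ (S.carrier ∪ T.carrier)
  nonempty := (S.nonempty.inl).convexHull'
  finitelyGenerated := by
    obtain ⟨B, hB, h⟩ := S.finitelyGenerated
    obtain ⟨B', hB', h'⟩ := T.finitelyGenerated
    exact ⟨B ∪ B', hB.union hB', by simp [h, h']⟩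

/-- The distribution `p φ + (1 - p) ψ`. -/
noncomputable def mix (p : Prob) (φ ψ : StdSimplex ℝ X) : StdSimplex ℝ X :=
  convexCombPair p.1 (1 - p.1) p.2.1.le (sub_nonneg.2 p.2.2.le) (by ring) φ ψ

theorem isAffineMap_mix_right (p : Prob) (φ : StdSimplex ℝ X) : IsAffineMap ℝ (mix p φ) :=
  isAffineMap_convexCombPair _ _ _ _

theorem mix_comm (p : Prob) (φ ψ : StdSimplex ℝ X) : mix p φ ψ = mix p.compl ψ φ := by
  ext : 1
  simp [mix, Prob.compl, add_comm]

theorem isAffineMap_mix_left (p : Prob) (ψ : StdSimplex ℝ X) :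
    IsAffineMap ℝ (fun φ => mix p φ ψ) := by
  simp_rw [mix_comm p _ ψ]
  exact isAffineMap_mix_right _ _

/-- An affine image of a mixture. -/
theorem mix_map {F : StdSimplex ℝ X → StdSimplex ℝ Y} (hF : IsAffineMap ℝ F) (p : Prob)
    (φ ψ : StdSimplex ℝ X) : F (mix p φ ψ) = mix p (F φ) (F ψ) :=
  hF.map_convexCombPair _ _ _ _ _

theorem convex_image2_mix (p : Prob) {U V : Set (StdSimplex ℝ X)} (hU : IsConvexSet ℝ U)
    (hV : IsConvexSet ℝ V) : IsConvexSet ℝ (Set.image2 (mix p) U V) := by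
  refine IsConvexSet.of_convexCombPair_mem ?_
  rintro a b ha hb hab _ ⟨s, hs, t, ht, rfl⟩ _ ⟨s', hs', t', ht', rfl⟩
  refine ⟨_, hU.convexCombPair_mem hs hs' ha hb hab, _,
    hV.convexCombPair_mem ht ht' ha hb hab, ?_⟩
  ext : 1
  simp only [mix, StdSimplex.weights_convexCombPair]
  module

theorem image2_mix_convexHull (p : Prob) (U V : Set (StdSimplex ℝ X)) :
    Set.image2 (mix p) (Convexity.convexHull ℝ U) (Convexity.convexHull ℝ V) =
      Convexity.convexHull ℝ (Set.image2 (mix p) U V) := by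
  apply Set.Subset.antisymm
  · rintro _ ⟨s, hs, t, ht, rfl⟩
    have key : ∀ s ∈ U, ∀ t ∈ Convexity.convexHull ℝ V,
        mix p s t ∈ Convexity.convexHull ℝ (Set.image2 (mix p) U V) := fun s hs =>
      convexHull_min (C := mix p s ⁻¹' _)
        (fun t ht => subset_convexHull_self (Set.mem_image2_of_mem hs ht))
        (IsConvexSet.convexHull.preimage (isAffineMap_mix_right p s))
    exact convexHull_min (C := (fun s => mix p s t) ⁻¹' _) (fun s hs => key s hs t ht)
      (IsConvexSet.convexHull.preimage (isAffineMap_mix_left p t)) hs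
  · exact convexHull_min
      (Set.image2_subset subset_convexHull_self subset_convexHull_self)
      (convex_image2_mix p .convexHull .convexHull)

/-- Weighted Minkowski sum `{p φ + (1 - p) ψ | φ ∈ S, ψ ∈ T}`. -/
noncomputable def minkowski (p : Prob) (S T : ConvSet X) : ConvSet X where
  carrier := Set.image2 (mix p) S.carrier T.carrier
  nonempty := S.nonempty.image2 T.nonempty
  finitelyGenerated := by
    obtain ⟨B, hB, h⟩ := S.finitelyGenerated
    obtain ⟨B', hB', h'⟩ := T.finitelyGenerated
    exact ⟨_, hB.image2 _ hB', by rw [h, h', image2_mix_convexHull]⟩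

theorem union_assoc (S T U : ConvSet X) : S.union (T.union U) = (S.union T).union U := by
  apply ConvSet.ext
  simp [union, Set.union_assoc]

theorem union_comm (S T : ConvSet X) : S.union T = T.union S := by
  apply ConvSet.ext
  simp [union, Set.union_comm]

theorem union_self (S : ConvSet X) : S.union S = S := by
  apply ConvSet.ext
  simp [union, S.convex.convexHull_eq_self]

theorem minkowski_assoc (p q : Prob) (S T U : ConvSet X) :
    minkowski p (minkowski q S T) U = minkowski (p.mul q) S (minkowski (p.skew q) T U) := by
  apply ConvSet.ext
  refine Set.image2_assoc fun a b c => ?_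
  have h := (Prob.mul p q).2.2
  ext : 1
  simp only [mix, StdSimplex.weights_convexCombPair, Prob.mul, Prob.skew] at h ⊢
  have h' : 1 - p.1 * q.1 ≠ 0 := by linarith
  have h1 : (1 - p.1 * q.1) * (p.1 * (1 - q.1) / (1 - p.1 * q.1)) = p.1 * (1 - q.1) := by
    field_simp
  have h2 : (1 - p.1 * q.1) * (1 - p.1 * (1 - q.1) / (1 - p.1 * q.1)) = 1 - p.1 := by
    field_simp; ring
  simp only [smul_add, smul_smul, h1, h2, add_assoc]

theorem minkowski_comm (p : Prob) (S T : ConvSet X) :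
    minkowski p S T = minkowski p.compl T S := by
  apply ConvSet.ext
  refine (Set.image2_swap _ _ _).trans ?_
  simp only [minkowski, mix_comm p]

theorem minkowski_self (p : Prob) (S : ConvSet X) : minkowski p S S = S := by
  apply ConvSet.ext
  apply Set.Subset.antisymm
  · rintro _ ⟨s, hs, t, ht, rfl⟩
    exact S.convex.convexCombPair_mem hs ht _ _ _
  · exact fun s hs => ⟨s, hs, s, hs, convexCombPair_same _ _ _⟩

theorem minkowski_union (p : Prob) (S T U : ConvSet X) :
    minkowski p S (T.union U) = (minkowski p S T).union (minkowski p S U) := by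
  apply ConvSet.ext
  have := image2_mix_convexHull p S.carrier (T.carrier ∪ U.carrier)
  rw [S.convex.convexHull_eq_self, Set.image2_union_right] at this
  exact this

end ConvSet

/-! ### The functor `C(· + 1)`

The element `none : Option X` is the element `⋆` of `X + 1`. -/

/-- The functor `X ↦ C(X + 1)`. -/
noncomputable def convPlusOne : Type u ⥤ Type u where
  obj X := ConvSet (Option X)
  map f := ↾(ConvSet.map (Option.map f))
  map_id X := by
    refine ConcreteCategory.hom_ext _ _ fun S => ?_
    exact (congrArg (fun g => ConvSet.map g S) Option.map_id).trans (ConvSet.map_id S)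
  map_comp f g := by
    refine ConcreteCategory.hom_ext _ _ fun S => ?_
    exact (congrArg (fun h => ConvSet.map h S) (Option.map_comp_map f g).symm).trans
      (ConvSet.map_map _ _ S).symm

/-- The pointed convex semilattice `C(X + 1)`, which is free on `X`: convex union, weighted
Minkowski sum and `{δ_⋆}`. -/
noncomputable def convPlusOneAlg (X : Type u) : Alg (ConvSet (Option X)) where
  star := ConvSet.dirac none
  oplus := ConvSet.union
  pplus := ConvSet.minkowski

theorem convPlusOneAlg_models (X : Type u) : (convPlusOneAlg X).Models pointedCS := by
  rintro _ (_ | _ | _ | _ | _ | _ | _) θ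
  · exact ConvSet.union_assoc ..
  · exact ConvSet.union_comm ..
  · exact ConvSet.union_self ..
  · exact ConvSet.minkowski_assoc ..
  · exact ConvSet.minkowski_comm ..
  · exact ConvSet.minkowski_self ..
  · exact ConvSet.minkowski_union ..

/-- The unit `x ↦ {δ_x}`. -/
noncomputable def convPlusOneUnit {X : Type u} (x : X) : ConvSet (Option X) :=
  ConvSet.dirac (some x)

/-- The canonical isomorphism from terms modulo the theory of pointed convex semilattices to
`C(X + 1)`: the homomorphism that extends the unit. -/
noncomputable def convPlusOneSigma (X : Type u) : TermMod pointedCS X → ConvSet (Option X) :=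
  TermMod.lift (convPlusOneAlg_models X) convPlusOneUnit

/-! ### The functor `C + 1`

The element `none : Option (ConvSet X)` is the element `⋆` of `C(X) + 1`. -/

/-- The functor `X ↦ C(X) + 1`. -/
noncomputable def plusOneConv : Type u ⥤ Type u where
  obj X := Option (ConvSet X)
  map f := ↾(Option.map (ConvSet.map f))
  map_id X := by
    refine ConcreteCategory.hom_ext _ _ fun S => ?_
    cases S with
    | none => rfl
    | some S => exact congrArg some (ConvSet.map_id S)
  map_comp f g := by
    refine ConcreteCategory.hom_ext _ _ fun S => ?_
    cases S with
    | none => rfl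
    | some S => exact congrArg some (ConvSet.map_map f g S).symm

/-- `C(X) + 1` with convex union and weighted Minkowski sum, extended to the new element `⋆`
(the empty set of distributions), neutral for convex union and absorbing for all weighted
Minkowski sums. -/
noncomputable def plusOneConvAlg (X : Type u) : Alg (Option (ConvSet X)) where
  star := none
  oplus := fun S T => match S, T with
    | some S, some T => some (ConvSet.union S T)
    | some S, none => some S
    | none, T => T
  pplus := fun p S T => match S, T with
    | some S, some T => some (ConvSet.minkowski p S T)
    | _, _ => none

theorem plusOneConvAlg_models (X : Type u) :
    (plusOneConvAlg X).Models bottomBlackHoleCS := by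
  rintro e ((he | rfl) | ⟨p, rfl⟩) θ
  · rcases he with _ | _ | _ | _ | _ | _ | _
    · rcases h0 : θ 0 with _ | S <;> rcases h1 : θ 1 with _ | T <;> rcases h2 : θ 2 with _ | U <;>
        simp [Term.eval, plusOneConvAlg, h0, h1, h2, ConvSet.union_assoc]
    · rcases h0 : θ 0 with _ | S <;> rcases h1 : θ 1 with _ | T <;>
        simp [Term.eval, plusOneConvAlg, h0, h1, ConvSet.union_comm]
    · rcases h0 : θ 0 with _ | S <;>
        simp [Term.eval, plusOneConvAlg, h0, ConvSet.union_self]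
    · rcases h0 : θ 0 with _ | S <;> rcases h1 : θ 1 with _ | T <;> rcases h2 : θ 2 with _ | U <;>
        simp [Term.eval, plusOneConvAlg, h0, h1, h2, ConvSet.minkowski_assoc]
    · rcases h0 : θ 0 with _ | S <;> rcases h1 : θ 1 with _ | T <;>
        simp [Term.eval, plusOneConvAlg, h0, h1]
      exact ConvSet.minkowski_comm ..
    · rcases h0 : θ 0 with _ | S <;>
        simp [Term.eval, plusOneConvAlg, h0, ConvSet.minkowski_self]
    · rcases h0 : θ 0 with _ | S <;> rcases h1 : θ 1 with _ | T <;> rcases h2 : θ 2 with _ | U <;>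
        simp [Term.eval, plusOneConvAlg, h0, h1, h2, ConvSet.minkowski_union]
  · rcases h0 : θ 0 with _ | S <;> simp [Term.eval, plusOneConvAlg, h0]
  · rcases h0 : θ 0 with _ | S <;> simp [Term.eval, plusOneConvAlg, h0]

/-- The unit `x ↦ {δ_x}`. -/
noncomputable def plusOneConvUnit {X : Type u} (x : X) : Option (ConvSet X) :=
  some (ConvSet.dirac x)

/-- The canonical isomorphism from terms modulo the theory of convex semilattices with bottom and
black hole to `C(X) + 1`: the homomorphism that extends the unit. -/
noncomputable def plusOneConvSigma (X : Type u) :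
    TermMod bottomBlackHoleCS X → Option (ConvSet X) :=
  TermMod.lift (plusOneConvAlg_models X) plusOneConvUnit

/-! ### The functor `C^↓` of `⊥`-closed convex sets -/

/-- `⊥`-closedness: with `φ`, the set contains every distribution `ψ` on `X + 1` which is
pointwise below `φ` on `X`. -/
def IsBotClosed {X : Type u} (S : ConvSet (Option X)) : Prop :=
  ∀ φ ∈ S.carrier, ∀ ψ : StdSimplex ℝ (Option X),
    (∀ x : X, ψ.weights (some x) ≤ φ.weights (some x)) → ψ ∈ S.carrier

section Damp

variable {X Y : Type u}

/-- Keep `x` with probability `r x`, and move to `⋆` otherwise. -/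
noncomputable def dampPoint (r : X → Set.Icc (0 : ℝ) 1) : Option X → StdSimplex ℝ (Option X)
  | none => .single none
  | some x => .duple (some x) none (r x).2.1 (sub_nonneg.2 (r x).2.2) (by ring)

/-- Multiply the weight of each `x : X` by `r x`. -/
noncomputable def damp (r : X → Set.Icc (0 : ℝ) 1) (φ : StdSimplex ℝ (Option X)) :
    StdSimplex ℝ (Option X) :=
  φ.iConvexComb (dampPoint r)

theorem damp_weights (r : X → Set.Icc (0 : ℝ) 1) (φ : StdSimplex ℝ (Option X)) (x : X) :
    (damp r φ).weights (some x) = φ.weights (some x) * (r x).1 := by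
  classical
  rw [damp, StdSimplex.weights_iConvexComb, Finsupp.sum_apply, Finsupp.sum,
    Finset.sum_eq_single (some x)]
  · simp [dampPoint]
  · rintro (_ | y) - hy
    · simp [dampPoint]
    · have : y ≠ x := fun h => hy (by rw [h])
      simp [dampPoint, this]
  · intro h
    simp [Finsupp.notMem_support_iff.1 h]

theorem stdSimplex_option_ext {φ ψ : StdSimplex ℝ (Option X)}
    (h : ∀ x : X, φ.weights (some x) = ψ.weights (some x)) : φ = ψ := by
  classical
  have tot : ∀ χ : StdSimplex ℝ (Option X),
      χ.weights none + χ.weights.some.sum (fun _ r => r) = 1 := fun χ => by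
    rw [← χ.total, Finsupp.sum_option_index _ _ (by simp) (by simp)]
  have hs : φ.weights.some = ψ.weights.some := Finsupp.ext fun x => by simp [h]
  ext o
  cases o with
  | none => have h1 := tot φ; have h2 := tot ψ; rw [hs] at h1; linarith
  | some x => exact h x

theorem exists_damp {φ ψ : StdSimplex ℝ (Option X)}
    (h : ∀ x : X, ψ.weights (some x) ≤ φ.weights (some x)) :
    ∃ r : X → Set.Icc (0 : ℝ) 1, damp r φ = ψ := by
  refine ⟨fun x => ⟨ψ.weights (some x) / φ.weights (some x),
    div_nonneg (ψ.nonneg _) (φ.nonneg _), div_le_one_of_le₀ (h x) (φ.nonneg _)⟩, ?_⟩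
  refine stdSimplex_option_ext fun x => ?_
  rw [damp_weights]
  change φ.weights (some x) * (ψ.weights (some x) / φ.weights (some x)) = _
  by_cases h0 : φ.weights (some x) = 0
  · have := h x
    have h1 : 0 ≤ ψ.weights (some x) := ψ.nonneg _
    rw [h0] at this ⊢
    linarith
  · exact mul_div_cancel₀ _ h0

theorem isBotClosed_iff {S : ConvSet (Option X)} :
    IsBotClosed S ↔ ∀ r, ∀ φ ∈ S.carrier, damp r φ ∈ S.carrier := by
  constructor
  · intro h r φ hφ
    refine h φ hφ _ fun x => ?_
    rw [damp_weights]
    exact mul_le_of_le_one_right (φ.nonneg _) (r x).2.2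
  · intro h φ hφ ψ hψ
    obtain ⟨r, rfl⟩ := exists_damp hψ
    exact h r φ hφ

theorem isAffineMap_damp (r : X → Set.Icc (0 : ℝ) 1) : IsAffineMap ℝ (damp r) where
  map_sConvexComb s := by
    unfold damp
    rw [← iConvexComb_id, ← iConvexComb_assoc]
    rfl

end Damp

theorem IsBotClosed.map {X Y : Type u} (f : X → Y) {S : ConvSet (Option X)}
    (h : IsBotClosed S) : IsBotClosed (S.map (Option.map f)) := by
  rw [isBotClosed_iff] at h ⊢
  rintro r _ ⟨φ, hφ, rfl⟩
  refine ⟨_, h (r ∘ f) φ hφ, ?_⟩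
  rw [damp, damp, map_iConvexComb, iConvexComb_map]
  congr 1
  funext o
  cases o <;> simp [dampPoint]

theorem IsBotClosed.union {X : Type u} {S T : ConvSet (Option X)} (hS : IsBotClosed S)
    (hT : IsBotClosed T) : IsBotClosed (S.union T) := by
  rw [isBotClosed_iff] at hS hT ⊢
  intro r
  refine convexHull_min (C := damp r ⁻¹' _) ?_
    (IsConvexSet.convexHull.preimage (isAffineMap_damp r))
  rintro φ (hφ | hφ)
  · exact subset_convexHull_self (Or.inl (hS r φ hφ))
  · exact subset_convexHull_self (Or.inr (hT r φ hφ))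

theorem IsBotClosed.minkowski {X : Type u} (p : Prob) {S T : ConvSet (Option X)}
    (hS : IsBotClosed S) (hT : IsBotClosed T) : IsBotClosed (S.minkowski p T) := by
  rw [isBotClosed_iff] at hS hT ⊢
  rintro r _ ⟨φ, hφ, ψ, hψ, rfl⟩
  exact ⟨_, hS r φ hφ, _, hT r ψ hψ, (ConvSet.mix_map (isAffineMap_damp r) p φ ψ).symm⟩

theorem isBotClosed_dirac_none (X : Type u) : IsBotClosed (ConvSet.dirac (none : Option X)) := by
  rw [isBotClosed_iff]
  rintro r _ rfl
  simp [damp, dampPoint, ConvSet.dirac]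

/-- `cc {δ_x, δ_⋆}` -/
noncomputable def segment {X : Type u} (x : X) : ConvSet (Option X) :=
  ConvSet.cc {StdSimplex.single (some x), StdSimplex.single none} (Set.toFinite _)
    (Set.insert_nonempty _ _)

theorem isBotClosed_segment {X : Type u} (x : X) : IsBotClosed (segment x) := by
  rw [isBotClosed_iff]
  intro r
  refine convexHull_min (C := damp r ⁻¹' _) ?_
    (IsConvexSet.convexHull.preimage (isAffineMap_damp r))
  have h1 : StdSimplex.single (some x) ∈ (segment x).carrier :=
    subset_convexHull_self (Or.inl rfl)
  have h2 : StdSimplex.single none ∈ (segment x).carrier :=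
    subset_convexHull_self (Or.inr rfl)
  rintro φ (rfl | rfl)
  · have := (segment x).convex.convexCombPair_mem h1 h2 (r x).2.1 (sub_nonneg.2 (r x).2.2)
      (by ring)
    have e : damp r (.single (some x)) = convexCombPair (r x).1 (1 - (r x).1) (r x).2.1
        (sub_nonneg.2 (r x).2.2) (by ring) (.single (some x)) (.single none) := by
      rw [damp, iConvexComb_single]
      ext : 1
      simp [dampPoint]
    exact Set.mem_preimage.2 (e ▸ this)
  · have e : damp r (.single none) = .single none := by
      rw [damp, iConvexComb_single]
      rfl
    exact Set.mem_preimage.2 (e.symm ▸ h2)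

/-- The functor `X ↦ C^↓(X)`. -/
noncomputable def convDown : Type u ⥤ Type u where
  obj X := {S : ConvSet (Option X) // IsBotClosed S}
  map f := ↾(fun S => ⟨S.1.map (Option.map f), S.2.map f⟩)
  map_id X := by
    refine ConcreteCategory.hom_ext _ _ fun S => Subtype.ext ?_
    exact (congrArg (fun g => ConvSet.map g S.1) Option.map_id).trans (ConvSet.map_id S.1)
  map_comp f g := by
    refine ConcreteCategory.hom_ext _ _ fun S => Subtype.ext ?_
    exact (congrArg (fun h => ConvSet.map h S.1) (Option.map_comp_map f g).symm).trans
      (ConvSet.map_map _ _ S.1).symm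

/-- `C^↓(X)` with convex union, weighted Minkowski sum and `{δ_⋆}`. -/
noncomputable def convDownAlg (X : Type u) : Alg {S : ConvSet (Option X) // IsBotClosed S} where
  star := ⟨ConvSet.dirac none, isBotClosed_dirac_none X⟩
  oplus S T := ⟨S.1.union T.1, S.2.union T.2⟩
  pplus p S T := ⟨S.1.minkowski p T.1, S.2.minkowski p T.2⟩

theorem convDownAlg_models (X : Type u) : (convDownAlg X).Models bottomCS := by
  rintro e (he | rfl) θ
  · rcases he with _ | _ | _ | _ | _ | _ | _
    · exact Subtype.ext (ConvSet.union_assoc ..)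
    · exact Subtype.ext (ConvSet.union_comm ..)
    · exact Subtype.ext (ConvSet.union_self ..)
    · exact Subtype.ext (ConvSet.minkowski_assoc ..)
    · exact Subtype.ext (ConvSet.minkowski_comm ..)
    · exact Subtype.ext (ConvSet.minkowski_self ..)
    · exact Subtype.ext (ConvSet.minkowski_union ..)
  · refine Subtype.ext (ConvSet.ext ?_)
    obtain ⟨φ, hφ⟩ := (θ 0).1.nonempty
    have h : StdSimplex.single none ∈ (θ 0).1.carrier :=
      (θ 0).2 φ hφ _ fun x => by simp
    have h' : (θ 0).1.carrier ∪ {StdSimplex.single none} = (θ 0).1.carrier :=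
      Set.union_eq_left.2 (Set.singleton_subset_iff.2 h)
    exact (congrArg (Convexity.convexHull ℝ) h').trans (θ 0).1.convex.convexHull_eq_self

/-- The unit `x ↦ cc {δ_x, δ_⋆}`. -/
noncomputable def convDownUnit {X : Type u} (x : X) :
    {S : ConvSet (Option X) // IsBotClosed S} :=
  ⟨segment x, isBotClosed_segment x⟩

/-- The canonical isomorphism from terms modulo the theory of convex semilattices with bottom to
`C^↓(X)`: the homomorphism that extends the unit. -/
noncomputable def convDownSigma (X : Type u) :
    TermMod bottomCS X → {S : ConvSet (Option X) // IsBotClosed S} :=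
  TermMod.lift (convDownAlg_models X) convDownUnit

/-! ### Processes, the proof system, behavioural equivalence -/

/-- Process terms `nil`, `a.P`, `P ⊕ Q`, `P +_p Q` with actions `a : A`. -/
inductive Proc (A : Type u) : Type u
  | nil : Proc A
  | act (a : A) (P : Proc A) : Proc A
  | oplus (P Q : Proc A) : Proc A
  | pplus (p : Prob) (P Q : Proc A) : Proc A

/-- The transition function: a process term steps to a term over process terms. -/
def Proc.step {A : Type u} : Proc A → Term (Proc A)
  | nil => .star
  | act _ P => .var P
  | oplus P Q => .oplus P.step Q.step
  | pplus p P Q => .pplus p P.step Q.step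

/-- The relation on process terms defined by the proof system of the theory `E`. It is the
smallest relation closed under the rule: if premises `R` have been proved, and `step P = step Q`
is derivable in equational logic from `E` and the equations `R`, then `P` and `Q` are related. -/
inductive ProvablyEq (E : Equations) {A : Type u} : Proc A → Proc A → Prop
  | rule (R : Proc A → Proc A → Prop) (hR : ∀ P Q, R P Q → ProvablyEq E P Q) {P Q : Proc A}
      (h : Derivable E R P.step Q.step) : ProvablyEq E P Q

/-- Process terms as a `C(· + 1)`-coalgebra. -/
noncomputable def procConvPlusOne (A : Type u) : Endofunctor.Coalgebra convPlusOne.{u} where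
  V := Proc A
  str := ↾fun P => convPlusOneSigma (Proc A) (Quotient.mk _ P.step)

/-- Process terms as a `(C + 1)`-coalgebra. -/
noncomputable def procPlusOneConv (A : Type u) : Endofunctor.Coalgebra plusOneConv.{u} where
  V := Proc A
  str := ↾fun P => plusOneConvSigma (Proc A) (Quotient.mk _ P.step)

/-- Process terms as a `C^↓`-coalgebra. -/
noncomputable def procConvDown (A : Type u) : Endofunctor.Coalgebra convDown.{u} where
  V := Proc A
  str := ↾fun P => convDownSigma (Proc A) (Quotient.mk _ P.step)

/-- An equivalence relation `R` on the states of a coalgebra is a behavioural equivalence if the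
transitions of related states are identified by the functor applied to the quotient map. -/
def IsBehaviouralEquivalence {F : Type u ⥤ Type u} (V : Endofunctor.Coalgebra F)
    (R : Setoid V.V) : Prop :=
  ∀ x y : V.V, R x y →
    F.map (↾(Quotient.mk R)) (V.str x) = F.map (↾(Quotient.mk R)) (V.str y)

/-- Two states are behaviourally equivalent if some behavioural equivalence relates them. -/
def BehaviourallyEquivalent {F : Type u ⥤ Type u} (V : Endofunctor.Coalgebra F)
    (x y : V.V) : Prop :=
  ∃ R : Setoid V.V, IsBehaviouralEquivalence V R ∧ R x y

end NDProb

/-! Provable equality satisfies its own rule with itself as the set of premises (`provablyEq_iff`),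
so it is an equivalence relation. It is a behavioural equivalence by soundness: the monad's algebra
over the quotient models the theory and identifies provably equal generators, while the functor
applied to the quotient map acts on interpreted terms by renaming generators (`convPlusOne_map_eval`
and its two analogues).

Conversely, let `R` be a behavioural equivalence. The transition terms of related processes, renamed
to classes of `R`, agree in the monad's algebra. The theory is complete for that algebra, so they
agree in every model. Apply this to terms modulo the theory and provable equality, with each class
sent to a chosen representative. It remains to replace each generator by its representative.
Generators of a transition term have smaller action depth, so an induction on depth does this,
provided the representatives are also chosen of small depth (`provablyEq_of_eval_eq`).

Completeness is proved by recovering the value of a term in any model from its convex set alone. A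
valuation extends to distributions by barycentres (`Alg.Models.exists_barycentre`), built by finite
summation in a commutative monoid, the cone over the model. The value of a term is then the join of
the barycentres of its convex set (`Term.isJoin_eval`), and such a join is unique
(`Alg.IsJoin.unique`). -/

namespace NDProb

/-! ### Models of the theory of convex semilattices -/

namespace Alg

variable {α : Type v} {𝔸 : Alg α}

/-- The valuation of the variables `0`, `1`, `2` by `x`, `y`, `z`. -/
def valuation (x y z : α) : ℕ → α
  | 0 => x
  | 1 => y
  | _ => z

theorem Models.mono {E E' : Equations} (h : 𝔸.Models E) (hE : E' ⊆ E) : 𝔸.Models E' :=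
  fun e he => h e (hE he)

section ConvexSemilattice

theorem Models.oplus_assoc (h : 𝔸.Models pointedCS) (x y z : α) :
    𝔸.oplus x (𝔸.oplus y z) = 𝔸.oplus (𝔸.oplus x y) z :=
  h _ CSAxiom.A (valuation x y z)

theorem Models.oplus_comm (h : 𝔸.Models pointedCS) (x y : α) :
    𝔸.oplus x y = 𝔸.oplus y x :=
  h _ CSAxiom.C (valuation x y y)

theorem Models.oplus_self (h : 𝔸.Models pointedCS) (x : α) : 𝔸.oplus x x = x :=
  h _ CSAxiom.I (valuation x x x)

theorem Models.pplus_assoc (h : 𝔸.Models pointedCS) (p q : Prob) (x y z : α) :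
    𝔸.pplus p (𝔸.pplus q x y) z = 𝔸.pplus (p.mul q) x (𝔸.pplus (p.skew q) y z) :=
  h _ (CSAxiom.Ap p q) (valuation x y z)

theorem Models.pplus_comm (h : 𝔸.Models pointedCS) (p : Prob) (x y : α) :
    𝔸.pplus p x y = 𝔸.pplus p.compl y x :=
  h _ (CSAxiom.Cp p) (valuation x y y)

theorem Models.pplus_self (h : 𝔸.Models pointedCS) (p : Prob) (x : α) : 𝔸.pplus p x x = x :=
  h _ (CSAxiom.Ip p) (valuation x x x)

theorem Models.pplus_oplus (h : 𝔸.Models pointedCS) (p : Prob) (x y z : α) :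
    𝔸.pplus p x (𝔸.oplus y z) = 𝔸.oplus (𝔸.pplus p x y) (𝔸.pplus p x z) :=
  h _ (CSAxiom.D p) (valuation x y z)

theorem Models.oplus_pplus (h : 𝔸.Models pointedCS) (p : Prob) (x y z : α) :
    𝔸.pplus p (𝔸.oplus x y) z = 𝔸.oplus (𝔸.pplus p x z) (𝔸.pplus p y z) := by
  rw [h.pplus_comm, h.pplus_oplus, ← h.pplus_comm, ← h.pplus_comm]

/-! ### The semilattice order and its finite joins. -/

variable (𝔸) in
/-- The order of the semilattice `⊕`. -/
def Le (x y : α) : Prop := 𝔸.oplus x y = y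

theorem Models.le_antisymm (h : 𝔸.Models pointedCS) {x y : α} (hxy : 𝔸.Le x y)
    (hyx : 𝔸.Le y x) : x = y :=
  hyx.symm.trans ((h.oplus_comm y x).trans hxy)

theorem Models.le_refl (h : 𝔸.Models pointedCS) (x : α) : 𝔸.Le x x := h.oplus_self x

theorem Models.le_trans (h : 𝔸.Models pointedCS) {x y z : α} (hxy : 𝔸.Le x y)
    (hyz : 𝔸.Le y z) : 𝔸.Le x z := by
  unfold Le at *
  rw [← hyz, h.oplus_assoc, hxy]

theorem Models.le_oplus_left (h : 𝔸.Models pointedCS) (x y : α) : 𝔸.Le x (𝔸.oplus x y) := by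
  unfold Le
  rw [h.oplus_assoc, h.oplus_self]

theorem Models.le_oplus_right (h : 𝔸.Models pointedCS) (x y : α) : 𝔸.Le y (𝔸.oplus x y) := by
  rw [h.oplus_comm]
  exact h.le_oplus_left y x

theorem Models.oplus_le (h : 𝔸.Models pointedCS) {x y z : α} (hx : 𝔸.Le x z)
    (hy : 𝔸.Le y z) : 𝔸.Le (𝔸.oplus x y) z := by
  unfold Le at *
  rw [← h.oplus_assoc, hy, hx]

/-- Distributivity turns a join in one argument into a join of mixtures, so `+_p` is monotone in
each argument separately. -/
theorem Models.pplus_mono (h : 𝔸.Models pointedCS) (p : Prob) {x x' y y' : α}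
    (hx : 𝔸.Le x x') (hy : 𝔸.Le y y') : 𝔸.Le (𝔸.pplus p x y) (𝔸.pplus p x' y') := by
  refine h.le_trans (y := 𝔸.pplus p x y') ?_ ?_
  · unfold Le at *
    rw [← h.pplus_oplus, hy]
  · unfold Le at *
    rw [← h.oplus_pplus, hx]

/-- The elements of `α` that are joins of finitely many elements of `s`. -/
inductive FiniteJoin (𝔸 : Alg α) (s : Set α) : α → Prop
  | of {x : α} (hx : x ∈ s) : FiniteJoin 𝔸 s x
  | oplus {x y : α} : FiniteJoin 𝔸 s x → FiniteJoin 𝔸 s y → FiniteJoin 𝔸 s (𝔸.oplus x y)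

theorem FiniteJoin.mono {s t : Set α} (hst : s ⊆ t) {x : α} (hx : 𝔸.FiniteJoin s x) :
    𝔸.FiniteJoin t x := by
  induction hx with
  | of hx => exact .of (hst hx)
  | oplus _ _ ihx ihy => exact .oplus ihx ihy

theorem FiniteJoin.le (h : 𝔸.Models pointedCS) {s : Set α} {x b : α}
    (hx : 𝔸.FiniteJoin s x) (hb : ∀ y ∈ s, 𝔸.Le y b) : 𝔸.Le x b := by
  induction hx with
  | of hx => exact hb _ hx
  | oplus _ _ ihx ihy => exact h.oplus_le ihx ihy

/-- Distributivity on both sides expands a mixture of two joins into the join of all pairwise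
mixtures. -/
theorem FiniteJoin.pplus (h : 𝔸.Models pointedCS) (p : Prob) {s t : Set α} {x y : α}
    (hx : 𝔸.FiniteJoin s x) (hy : 𝔸.FiniteJoin t y) :
    𝔸.FiniteJoin (Set.image2 (𝔸.pplus p) s t) (𝔸.pplus p x y) := by
  induction hx with
  | of hx =>
    induction hy with
    | of hy => exact .of (Set.mem_image2_of_mem hx hy)
    | oplus _ _ ihx ihy => rw [h.pplus_oplus]; exact .oplus ihx ihy
  | oplus _ _ ihx ihy => rw [h.oplus_pplus]; exact .oplus ihx ihy

end ConvexSemilattice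

/-! ### The cone over a convex algebra -/

/-- The probability `r / (r + s)`. -/
noncomputable def ratio (r s : {r : ℝ // 0 < r}) : Prob :=
  ⟨r.1 / (r.1 + s.1), div_pos r.2 (add_pos r.2 s.2),
    (div_lt_one (add_pos r.2 s.2)).2 (lt_add_of_pos_right _ s.2)⟩

/-- The sum of two positive numbers. -/
def addPos (r s : {r : ℝ // 0 < r}) : {r : ℝ // 0 < r} := ⟨r.1 + s.1, add_pos r.2 s.2⟩

/-- The cone over a convex semilattice: an apex, and the points of `α` with a positive mass. -/
def Cone {α : Type v} {𝔸 : Alg α} (_ : 𝔸.Models pointedCS) : Type v :=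
  Option ({r : ℝ // 0 < r} × α)

namespace Cone

variable (h : 𝔸.Models pointedCS)

/-- Addition of masses, with the point in the barycentre. -/
noncomputable def add : Cone h → Cone h → Cone h
  | none, b => b
  | some a, none => some a
  | some (r, x), some (s, y) => some (addPos r s, 𝔸.pplus (ratio r s) x y)

noncomputable instance : Add (Cone h) := ⟨add h⟩

instance : Zero (Cone h) := ⟨none⟩

noncomputable instance : AddCommMonoid (Cone h) where
  zero_add _ := rfl
  add_zero a := by cases a <;> rfl
  nsmul := nsmulRec
  add_comm a b := by
    rcases a with _ | ⟨r, x⟩ <;> rcases b with _ | ⟨s, y⟩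
    · rfl
    · rfl
    · rfl
    · refine congrArg some (Prod.ext (Subtype.ext (add_comm _ _)) ?_)
      refine (h.pplus_comm _ _ _).trans (congrArg (fun p => 𝔸.pplus p y x) (Subtype.ext ?_))
      have hrs : r.1 + s.1 ≠ 0 := (add_pos r.2 s.2).ne'
      simp only [Prob.compl, ratio]
      rw [one_sub_div hrs, add_sub_cancel_left, add_comm r.1]
  add_assoc a b c := by
    rcases a with _ | ⟨r, x⟩
    · rfl
    rcases b with _ | ⟨s, y⟩
    · rfl
    rcases c with _ | ⟨t, z⟩
    · rfl
    refine congrArg some (Prod.ext (Subtype.ext (add_assoc _ _ _)) ?_)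
    -- With `p = (r+s)/(r+s+t)` and `q = r/(r+s)`, the weights in the associativity axiom become `pq
    -- = r/(r+s+t)` and `p(1-q)/(1-pq) = s/(s+t)`, which are the ratios of the other bracketing.
    refine (h.pplus_assoc _ _ _ _ _).trans ?_
    have hr : 0 < r.1 := r.2
    have hs : 0 < s.1 := s.2
    have ht : 0 < t.1 := t.2
    have h1 : (ratio (addPos r s) t).mul (ratio r s) = ratio r (addPos s t) := by
      refine Subtype.ext ?_
      simp only [Prob.mul, ratio, addPos]
      field_simp
      ring
    have h2 : (ratio (addPos r s) t).skew (ratio r s) = ratio s t := by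
      have e1 := congrArg Subtype.val h1
      refine Subtype.ext ?_
      simp only [Prob.mul, Prob.skew, ratio, addPos] at e1 ⊢
      rw [e1]
      have e2 : 1 - r.1 / (r.1 + (s.1 + t.1)) = (s.1 + t.1) / (r.1 + (s.1 + t.1)) := by
        field_simp
        ring
      rw [e2]
      field_simp
      ring
    simp only [h1, h2]

/-- The point `x` with mass `r`, which is the apex unless `r` is positive. -/
noncomputable def point (r : ℝ) (x : α) : Cone h :=
  open Classical in if hr : 0 < r then some (⟨r, hr⟩, x) else none

theorem point_of_pos {r : ℝ} (hr : 0 < r) (x : α) : point h r x = some (⟨r, hr⟩, x) :=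
  dif_pos hr

@[simp] theorem point_zero (x : α) : point h 0 x = 0 := dif_neg (lt_irrefl _)

/-- This is idempotence of `+_p`. Signs matter, because `point` sends every negative mass to the
apex. -/
theorem point_add {r s : ℝ} (hr : 0 ≤ r) (hs : 0 ≤ s) (x : α) :
    point h (r + s) x = point h r x + point h s x := by
  rcases hr.eq_or_lt with rfl | hr
  · simp
  rcases hs.eq_or_lt with rfl | hs
  · simp
  rw [point_of_pos h (add_pos hr hs), point_of_pos h hr, point_of_pos h hs]
  exact congrArg some (Prod.ext rfl (h.pplus_self _ _).symm)

theorem point_injective {x y : α} (hxy : point h 1 x = point h 1 y) : x = y := by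
  rw [point_of_pos h one_pos, point_of_pos h one_pos] at hxy
  exact congrArg Prod.snd (Option.some.inj hxy)

/-- A mixture in `α` is a sum in the cone of points of masses `p` and `1 - p`, so affine identities
in `α` reduce to additive ones. -/
theorem point_add_point (p : Prob) (x y : α) :
    point h p.1 x + point h (1 - p.1) y = point h 1 (𝔸.pplus p x y) := by
  have hp := p.2.1
  have hq : 0 < 1 - p.1 := sub_pos.2 p.2.2
  rw [point_of_pos h hp, point_of_pos h hq, point_of_pos h one_pos]
  refine congrArg some (Prod.ext (Subtype.ext (add_sub_cancel _ _)) ?_)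
  exact congrArg (fun p => 𝔸.pplus p x y) (Subtype.ext (by simp [ratio]))

/-- The mass of a point of the cone. -/
noncomputable def mass : Cone h →+ ℝ where
  toFun a := Option.elim a 0 fun a => a.1.1
  map_zero' := rfl
  map_add' a b := by
    rcases a with _ | ⟨r, x⟩
    · exact (zero_add _).symm
    rcases b with _ | ⟨s, y⟩
    · exact (add_zero _).symm
    rfl

theorem mass_point {r : ℝ} (hr : 0 ≤ r) (x : α) : mass h (point h r x) = r := by
  rcases hr.eq_or_lt with rfl | hr
  · simp
  · rw [point_of_pos h hr]
    rfl

/-- The slice of mass one is a copy of `α`; the apex, of mass zero, is excluded. -/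
theorem exists_eq_point {a : Cone h} (ha : mass h a = 1) : ∃ x, a = point h 1 x := by
  rcases a with _ | ⟨r, x⟩
  · exact absurd ha zero_ne_one
  · refine ⟨x, ?_⟩
    rw [point_of_pos h one_pos]
    exact congrArg some (Prod.ext (Subtype.ext ha) rfl)

/-- Multiplication of masses by a positive number. -/
noncomputable def scale (p : {r : ℝ // 0 < r}) : Cone h →+ Cone h where
  toFun a := Option.map (fun a => (⟨p.1 * a.1.1, mul_pos p.2 a.1.2⟩, a.2)) a
  map_zero' := rfl
  map_add' a b := by
    rcases a with _ | ⟨r, x⟩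
    · rfl
    rcases b with _ | ⟨s, y⟩
    · rfl
    refine congrArg some (Prod.ext (Subtype.ext (mul_add _ _ _)) ?_)
    refine congrArg (fun p => 𝔸.pplus p x y) (Subtype.ext ?_)
    simp only [ratio]
    rw [← mul_add, mul_div_mul_left _ _ (ne_of_gt p.2)]

theorem scale_point (p : {r : ℝ // 0 < r}) {r : ℝ} (hr : 0 ≤ r) (x : α) :
    scale h p (point h r x) = point h (p.1 * r) x := by
  rcases hr.eq_or_lt with rfl | hr
  · simp
  · rw [point_of_pos h hr, point_of_pos h (mul_pos p.2 hr)]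
    rfl

variable {Y : Type*} (η : Y → α)

/-- The sum of the points `η y` with masses `f y`. -/
noncomputable def total (f : Y →₀ ℝ) : Cone h := f.sum fun y r => point h r (η y)

/-- All three sums can be taken over the union of the supports, since a zero weight contributes the
apex; then `point_add` applies termwise. -/
theorem total_add {f g : Y →₀ ℝ} (hf : 0 ≤ f) (hg : 0 ≤ g) :
    total h η (f + g) = total h η f + total h η g := by
  classical
  have hsub : (f + g).support ⊆ f.support ∪ g.support := Finsupp.support_add
  unfold total
  rw [Finsupp.sum_of_support_subset _ hsub _ (by simp),
    Finsupp.sum_of_support_subset f Finset.subset_union_left _ (by simp),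
    Finsupp.sum_of_support_subset g Finset.subset_union_right _ (by simp),
    ← Finset.sum_add_distrib]
  exact Finset.sum_congr rfl fun y _ => point_add h (hf y) (hg y) _

theorem total_smul (p : {r : ℝ // 0 < r}) {f : Y →₀ ℝ} (hf : 0 ≤ f) :
    total h η (p.1 • f) = scale h p (total h η f) := by
  unfold total
  rw [Finsupp.sum_smul_index (by simp), Finsupp.sum, Finsupp.sum, map_sum]
  exact Finset.sum_congr rfl fun y _ => (scale_point h p (hf y) _).symm

theorem mass_total (φ : StdSimplex ℝ Y) : mass h (total h η φ.weights) = 1 := by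
  rw [← φ.total, total, Finsupp.sum, Finsupp.sum, map_sum]
  exact Finset.sum_congr rfl fun y _ => mass_point h (φ.nonneg y) _

end Cone

/-- The map from distributions that extends a valuation and preserves mixtures. -/
theorem Models.exists_barycentre (h : 𝔸.Models pointedCS) {Y : Type u} (η : Y → α) :
    ∃ β : StdSimplex ℝ Y → α, (∀ y, β (.single y) = η y) ∧
      ∀ p φ ψ, β (ConvSet.mix p φ ψ) = 𝔸.pplus p (β φ) (β ψ) := by
  -- The total of a distribution has mass one, hence lies over a point of `α`: its barycentre.
  choose β hβ using fun φ : StdSimplex ℝ Y => Cone.exists_eq_point h (Cone.mass_total h η φ)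
  refine ⟨β, fun y => Cone.point_injective h ?_, fun p φ ψ => Cone.point_injective h ?_⟩
  · rw [← hβ]
    simp [Cone.total]
  · have hp := p.2.1
    have hq : 0 < 1 - p.1 := sub_pos.2 p.2.2
    -- Both sides are now read in the cone, where additivity and homogeneity of `total` give the
    -- claim.
    rw [← hβ, ← Cone.point_add_point]
    simp only [ConvSet.mix, StdSimplex.weights_convexCombPair]
    rw [Cone.total_add h η (smul_nonneg hp.le φ.nonneg) (smul_nonneg hq.le ψ.nonneg),
      Cone.total_smul h η ⟨p.1, hp⟩ φ.nonneg, Cone.total_smul h η ⟨1 - p.1, hq⟩ ψ.nonneg, hβ, hβ,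
      Cone.scale_point h _ zero_le_one, Cone.scale_point h _ zero_le_one, mul_one, mul_one]

/-! ### Values of terms as joins of barycentres -/

section IsJoin

variable {Y : Type u} {β : StdSimplex ℝ Y → α}

/-- The element `x` is a join of finitely many barycentres of distributions in `S`, and an upper
bound of all of them. -/
structure IsJoin (𝔸 : Alg α) {Y : Type u} (β : StdSimplex ℝ Y → α)
    (S : Set (StdSimplex ℝ Y)) (x : α) : Prop where
  le : ∀ φ ∈ S, 𝔸.Le (β φ) x
  finiteJoin : 𝔸.FiniteJoin (β '' S) x

/-- Each element is a finite join of barycentres that the other bounds from above. Combining the two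
clauses avoids forming a join over all of `S`, which may be infinite. -/
theorem IsJoin.unique (h : 𝔸.Models pointedCS) {S : Set (StdSimplex ℝ Y)} {x y : α}
    (hx : 𝔸.IsJoin β S x) (hy : 𝔸.IsJoin β S y) : x = y :=
  h.le_antisymm (hx.finiteJoin.le h (Set.forall_mem_image.2 hy.le))
    (hy.finiteJoin.le h (Set.forall_mem_image.2 hx.le))

theorem IsJoin.single (h : 𝔸.Models pointedCS) (y : Y) :
    𝔸.IsJoin β {StdSimplex.single y} (β (.single y)) where
  le := by
    rintro _ rfl
    exact h.le_refl _
  finiteJoin := .of (Set.mem_image_of_mem _ rfl)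

/-- Mixing is monotone and `x +_p x = x`, so a mixture of two barycentres below `x` stays below `x`.
-/
theorem isConvexSet_le (h : 𝔸.Models pointedCS)
    (hβ : ∀ p φ ψ, β (ConvSet.mix p φ ψ) = 𝔸.pplus p (β φ) (β ψ)) (x : α) :
    IsConvexSet ℝ {φ | 𝔸.Le (β φ) x} := by
  refine IsConvexSet.of_convexCombPair_mem fun a b ha hb hab φ hφ ψ hψ => ?_
  -- The operations `+_p` exist only for `0 < p < 1`, so the weights `0` and `1` are treated apart.
  rcases ha.eq_or_lt with rfl | ha'
  · obtain rfl : b = 1 := by linarith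
    have : convexCombPair 0 1 ha hb hab φ ψ = ψ := by ext : 1; simp
    rwa [this]
  rcases hb.eq_or_lt with rfl | hb'
  · obtain rfl : a = 1 := by linarith
    have : convexCombPair 1 0 ha hb hab φ ψ = φ := by ext : 1; simp
    rwa [this]
  obtain rfl : b = 1 - a := by linarith
  have hmix := hβ ⟨a, ha', by linarith⟩ φ ψ
  change 𝔸.Le (β (ConvSet.mix ⟨a, ha', by linarith⟩ φ ψ)) x
  rw [hmix, ← h.pplus_self ⟨a, ha', by linarith⟩ x]
  exact h.pplus_mono _ hφ hψ

/-- Convex closure adds only points whose barycentres already lie below the join, by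
`isConvexSet_le`; the finite join itself needs only points of `S ∪ T`. -/
theorem IsJoin.convexHull_union (h : 𝔸.Models pointedCS)
    (hβ : ∀ p φ ψ, β (ConvSet.mix p φ ψ) = 𝔸.pplus p (β φ) (β ψ)) {S T : Set (StdSimplex ℝ Y)}
    {x y : α} (hx : 𝔸.IsJoin β S x) (hy : 𝔸.IsJoin β T y) :
    𝔸.IsJoin β (Convexity.convexHull ℝ (S ∪ T)) (𝔸.oplus x y) where
  le := by
    refine convexHull_min (C := {φ | 𝔸.Le (β φ) _}) ?_ (isConvexSet_le h hβ _)
    rintro φ (hφ | hφ)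
    · exact h.le_trans (hx.le φ hφ) (h.le_oplus_left x y)
    · exact h.le_trans (hy.le φ hφ) (h.le_oplus_right x y)
  finiteJoin := .oplus
    (hx.finiteJoin.mono
      (Set.image_mono (Set.subset_union_left.trans subset_convexHull_self)))
    (hy.finiteJoin.mono
      (Set.image_mono (Set.subset_union_right.trans subset_convexHull_self)))

theorem IsJoin.image2_mix (h : 𝔸.Models pointedCS)
    (hβ : ∀ p φ ψ, β (ConvSet.mix p φ ψ) = 𝔸.pplus p (β φ) (β ψ)) (p : Prob)
    {S T : Set (StdSimplex ℝ Y)} {x y : α} (hx : 𝔸.IsJoin β S x) (hy : 𝔸.IsJoin β T y) :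
    𝔸.IsJoin β (Set.image2 (ConvSet.mix p) S T) (𝔸.pplus p x y) where
  le := by
    rintro _ ⟨φ, hφ, ψ, hψ, rfl⟩
    rw [hβ]
    exact h.pplus_mono p (hx.le φ hφ) (hy.le ψ hψ)
  finiteJoin := by
    refine (hx.finiteJoin.pplus h p hy.finiteJoin).mono ?_
    rintro _ ⟨_, ⟨φ, hφ, rfl⟩, _, ⟨ψ, hψ, rfl⟩, rfl⟩
    exact ⟨_, Set.mem_image2_of_mem hφ hψ, hβ p φ ψ⟩

end IsJoin

end Alg

/-! ### Completeness of the theories for their monads -/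

section Completeness

variable {α : Type v} {𝔸 : Alg α} {X : Type u}

/-- The unit is left arbitrary so that the induction serves both `C(· + 1)`, with Dirac units, and
`C^↓`, whose units are segments. -/
theorem Term.isJoin_eval (h : 𝔸.Models pointedCS) {η : X → α}
    {β : StdSimplex ℝ (Option X) → α} (hstar : β (.single none) = 𝔸.star)
    (hβ : ∀ p φ ψ, β (ConvSet.mix p φ ψ) = 𝔸.pplus p (β φ) (β ψ))
    {unit : X → ConvSet (Option X)} (hunit : ∀ x, 𝔸.IsJoin β (unit x).carrier (η x))
    (t : Term X) : 𝔸.IsJoin β (t.eval (convPlusOneAlg X) unit).carrier (t.eval 𝔸 η) := by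
  induction t with
  | var x => exact hunit x
  | star =>
    have := Alg.IsJoin.single (β := β) h none
    rwa [hstar] at this
  | oplus s t hs ht => exact hs.convexHull_union h hβ ht
  | pplus p s t hs ht => exact hs.image2_mix h hβ p ht

/-- The two values are joins over the same convex set, hence equal. -/
theorem Term.eval_eq_of_convPlusOne (h : 𝔸.Models pointedCS) (η : X → α) {s t : Term X}
    (hst : s.eval (convPlusOneAlg X) convPlusOneUnit = t.eval (convPlusOneAlg X) convPlusOneUnit) :
    s.eval 𝔸 η = t.eval 𝔸 η := by
  obtain ⟨β, hη, hβ⟩ := h.exists_barycentre fun o : Option X => o.elim 𝔸.star η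
  have key := Term.isJoin_eval (η := η) (unit := convPlusOneUnit) h (hη none) hβ fun x => by
    have := Alg.IsJoin.single (β := β) h (some x)
    rwa [hη] at this
  exact (hst ▸ key s).unique h (key t)

theorem Term.eval_convDownAlg (unit : X → {S : ConvSet (Option X) // IsBotClosed S})
    (t : Term X) :
    (t.eval (convDownAlg X) unit).1 = t.eval (convPlusOneAlg X) fun x => (unit x).1 := by
  induction t with
  | var x => rfl
  | star => rfl
  | oplus s t hs ht => exact congrArg₂ ConvSet.union hs ht
  | pplus p s t hs ht => exact congrArg₂ (ConvSet.minkowski p) hs ht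

theorem Term.eval_eq_of_convDown (h : 𝔸.Models bottomCS) (η : X → α) {s t : Term X}
    (hst : s.eval (convDownAlg X) convDownUnit = t.eval (convDownAlg X) convDownUnit) :
    s.eval 𝔸 η = t.eval 𝔸 η := by
  have hbot (x : α) : 𝔸.oplus x 𝔸.star = x := h _ (Or.inr rfl) fun _ => x
  replace h : 𝔸.Models pointedCS := h.mono Set.subset_union_left
  obtain ⟨β, hη, hβ⟩ := h.exists_barycentre fun o : Option X => o.elim 𝔸.star η
  have key := Term.isJoin_eval (η := η) (unit := segment) h (hη none) hβ fun x => by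
    have h1 := Alg.IsJoin.single (β := β) h (some x)
    have h2 := Alg.IsJoin.single (β := β) h none
    rw [hη] at h1 h2
    have := h1.convexHull_union h hβ h2
    -- The join over the segment is `η x ⊕ ⋆`; the bottom axiom reduces it to `η x`, as the unit
    -- requires.
    rwa [Option.elim, Option.elim, hbot] at this
  have e := congrArg Subtype.val hst
  simp only [Term.eval_convDownAlg] at e
  exact (e ▸ key s).unique h (key t)

theorem Term.eval_eq_of_plusOneConv (h : 𝔸.Models bottomBlackHoleCS) (η : X → α) {s t : Term X}
    (hst : s.eval (plusOneConvAlg X) plusOneConvUnit = t.eval (plusOneConvAlg X) plusOneConvUnit) :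
    s.eval 𝔸 η = t.eval 𝔸 η := by
  have hbot (x : α) : 𝔸.oplus x 𝔸.star = x := h _ (Or.inl (Or.inr rfl)) fun _ => x
  have hbh (p : Prob) (x : α) : 𝔸.pplus p x 𝔸.star = 𝔸.star := h _ (Or.inr ⟨p, rfl⟩) fun _ => x
  replace h : 𝔸.Models pointedCS :=
    h.mono (Set.subset_union_left.trans Set.subset_union_left)
  have hbh' (p : Prob) (x : α) : 𝔸.pplus p 𝔸.star x = 𝔸.star := by rw [h.pplus_comm, hbh]
  -- Distributions live on `X` alone here, as `⋆` is no longer a point that can carry mass.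
  obtain ⟨β, hη, hβ⟩ := h.exists_barycentre η
  -- The added element plays the role of the empty set, over which no join exists; terms interpreted
  -- by it must be shown equal to `⋆` directly.
  have key (t : Term X) : (t.eval (plusOneConvAlg X) plusOneConvUnit).elim
      (t.eval 𝔸 η = 𝔸.star) fun S => 𝔸.IsJoin β S.carrier (t.eval 𝔸 η) := by
    induction t with
    | var x =>
      have := Alg.IsJoin.single (β := β) h x
      rwa [hη] at this
    | star => rfl
    | oplus s t hs ht =>
      simp only [Term.eval]
      generalize s.eval (plusOneConvAlg X) plusOneConvUnit = S at hs ⊢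
      generalize t.eval (plusOneConvAlg X) plusOneConvUnit = T at ht ⊢
      rcases S with _ | S <;> rcases T with _ | T <;>
        simp only [Option.elim, plusOneConvAlg] at hs ht ⊢
      · rw [hs, ht, hbot]
      · rwa [hs, h.oplus_comm, hbot]
      · rwa [ht, hbot]
      · exact hs.convexHull_union h hβ ht
    | pplus p s t hs ht =>
      simp only [Term.eval]
      generalize s.eval (plusOneConvAlg X) plusOneConvUnit = S at hs ⊢
      generalize t.eval (plusOneConvAlg X) plusOneConvUnit = T at ht ⊢
      rcases S with _ | S <;> rcases T with _ | T <;>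
        simp only [Option.elim, plusOneConvAlg] at hs ht ⊢
      · rw [hs, hbh']
      · rw [hs, hbh']
      · rw [ht, hbh]
      · exact hs.image2_mix h hβ p ht
  have hs := key s
  have ht := key t
  rw [hst] at hs
  generalize t.eval (plusOneConvAlg X) plusOneConvUnit = T at hs ht
  rcases T with _ | T
  · exact Eq.trans hs (Eq.symm ht)
  · exact Alg.IsJoin.unique h hs ht

end Completeness

/-! ### Naturality of the interpretation of terms -/

theorem Term.map_eval {X : Type u} {α β : Type*} {𝔸 : Alg α} {𝔹 : Alg β} {f : α → β}
    (hstar : f 𝔸.star = 𝔹.star) (hoplus : ∀ x y, f (𝔸.oplus x y) = 𝔹.oplus (f x) (f y))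
    (hpplus : ∀ p x y, f (𝔸.pplus p x y) = 𝔹.pplus p (f x) (f y)) (η : X → α) (t : Term X) :
    f (t.eval 𝔸 η) = t.eval 𝔹 fun x => f (η x) := by
  induction t with
  | var x => rfl
  | star => exact hstar
  | oplus s t hs ht => simp only [Term.eval, hoplus, hs, ht]
  | pplus p s t hs ht => simp only [Term.eval, hpplus, hs, ht]

namespace ConvSet

variable {X Y : Type u} (f : X → Y)

theorem map_dirac (x : X) : (dirac x).map f = dirac (f x) := by
  apply ConvSet.ext
  simp [map, dirac]

theorem map_union (S T : ConvSet X) : (S.union T).map f = (S.map f).union (T.map f) := by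
  apply ConvSet.ext
  simp [map, union, (StdSimplex.isAffineMap_map ℝ f).image_convexHull, Set.image_union]

theorem map_minkowski (p : Prob) (S T : ConvSet X) :
    (minkowski p S T).map f = minkowski p (S.map f) (T.map f) := by
  apply ConvSet.ext
  exact Set.image_image2_distrib fun φ ψ => mix_map (StdSimplex.isAffineMap_map ℝ f) p φ ψ

end ConvSet

theorem map_segment {X Y : Type u} (f : X → Y) (x : X) :
    (segment x).map (Option.map f) = segment (f x) := by
  apply ConvSet.ext
  simp [segment, ConvSet.map, ConvSet.cc, (StdSimplex.isAffineMap_map ℝ _).image_convexHull,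
    Set.image_pair]

/-- Naturality of the interpretation: direct image along `f` is a homomorphism and carries units to
units. -/
theorem convPlusOne_map_eval {X Y : Type u} (f : X → Y) (t : Term X) :
    (t.eval (convPlusOneAlg X) convPlusOneUnit).map (Option.map f) =
      (t.subst fun x => .var (f x)).eval (convPlusOneAlg Y) convPlusOneUnit := by
  rw [Term.eval_subst, Term.map_eval (𝔹 := convPlusOneAlg Y) (f := ConvSet.map (Option.map f))]
  · exact congrArg (fun η => t.eval _ η) (funext fun x => ConvSet.map_dirac _ _)
  · exact ConvSet.map_dirac _ _
  · exact ConvSet.map_union _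
  · exact ConvSet.map_minkowski _

theorem convDown_map_eval {X Y : Type u} (f : X → Y) (t : Term X) :
    convDown.map (↾f) (t.eval (convDownAlg X) convDownUnit) =
      (t.subst fun x => .var (f x)).eval (convDownAlg Y) convDownUnit := by
  rw [Term.eval_subst]
  refine (Term.map_eval (𝔸 := convDownAlg X) (𝔹 := convDownAlg Y)
    (f := fun S => ⟨S.1.map (Option.map f), S.2.map f⟩) ?_ ?_ ?_ convDownUnit t).trans ?_
  rotate_right
  · exact congrArg (fun η => t.eval _ η) (funext fun x => Subtype.ext (map_segment _ _))
  · exact Subtype.ext (ConvSet.map_dirac _ _)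
  · exact fun S T => Subtype.ext (ConvSet.map_union _ S.1 T.1)
  · exact fun p S T => Subtype.ext (ConvSet.map_minkowski _ p S.1 T.1)

theorem plusOneConv_map_eval {X Y : Type u} (f : X → Y) (t : Term X) :
    (t.eval (plusOneConvAlg X) plusOneConvUnit).map (ConvSet.map f) =
      (t.subst fun x => .var (f x)).eval (plusOneConvAlg Y) plusOneConvUnit := by
  rw [Term.eval_subst, Term.map_eval (𝔹 := plusOneConvAlg Y) (f := Option.map (ConvSet.map f))]
  · exact congrArg (fun η => t.eval _ η)
      (funext fun x => congrArg some (ConvSet.map_dirac _ _))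
  · rfl
  · rintro (_ | S) (_ | T)
    · rfl
    · rfl
    · rfl
    · exact congrArg some (ConvSet.map_union _ S T)
  · rintro p (_ | S) (_ | T)
    · rfl
    · rfl
    · rfl
    · exact congrArg some (ConvSet.map_minkowski _ p S T)

/-! ### The proof system -/

theorem Derivable.mono {E : Equations} {X : Type u} {R R' : X → X → Prop}
    (hR : ∀ x y, R x y → R' x y) {s t : Term X} (d : Derivable E R s t) : Derivable E R' s t := by
  induction d with
  | ax he θ => exact .ax he θ
  | hyp h => exact .hyp (hR _ _ h)
  | refl t => exact .refl t
  | symm _ ih => exact .symm ih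
  | trans _ _ ih ih' => exact .trans ih ih'
  | oplus _ _ ih ih' => exact .oplus ih ih'
  | pplus p _ _ ih ih' => exact .pplus p ih ih'

/-! ### The term model. -/

/-- Terms modulo provable equality from the equations `E` and `R`. -/
def derivableSetoid (E : Equations) {X : Type u} (R : X → X → Prop) : Setoid (Term X) where
  r := Derivable E R
  iseqv := ⟨.refl, .symm, .trans⟩

/-- The algebra of terms modulo provable equality from the equations `E` and `R`. -/
def derivableAlg (E : Equations) {X : Type u} (R : X → X → Prop) :
    Alg (Quotient (derivableSetoid E R)) where
  star := Quotient.mk _ .star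
  oplus := Quotient.map₂ .oplus fun _ _ h _ _ h' => Derivable.oplus h h'
  pplus p := Quotient.map₂ (.pplus p) fun _ _ h _ _ h' => Derivable.pplus p h h'

theorem eval_derivableAlg (E : Equations) {X Y : Type*} (R : X → X → Prop) (θ : Y → Term X)
    (t : Term Y) : t.eval (derivableAlg E R) (fun y => Quotient.mk _ (θ y)) =
      Quotient.mk (derivableSetoid E R) (t.subst θ) := by
  induction t with
  | var x => rfl
  | star => rfl
  | oplus s t hs ht => simp only [Term.eval, hs, ht]; rfl
  | pplus p s t hs ht => simp only [Term.eval, hs, ht]; rfl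

theorem derivableAlg_models (E : Equations) {X : Type u} (R : X → X → Prop) :
    (derivableAlg E R).Models E := by
  intro e he θ
  -- A valuation in the quotient is lifted to a substitution by terms, at which the axiom can be
  -- instantiated.
  obtain ⟨θ, rfl⟩ : ∃ θ' : ℕ → Term X, (fun n => Quotient.mk _ (θ' n)) = θ :=
    ⟨fun n => (θ n).out, funext fun n => Quotient.out_eq _⟩
  rw [eval_derivableAlg, eval_derivableAlg]
  exact Quotient.sound (.ax he θ)

/-- The generators that occur in a term. -/
def Term.vars {X : Type u} : Term X → Set X
  | .var x => {x}
  | .star => ∅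
  | .oplus s t => s.vars ∪ t.vars
  | .pplus _ s t => s.vars ∪ t.vars

/-- Only generators that occur in `t` are constrained, which lets a depth induction supply the
hypothesis. -/
theorem Derivable.subst_var {E : Equations} {X : Type u} {R : X → X → Prop} {f : X → X}
    {t : Term X} (hf : ∀ x ∈ t.vars, R x (f x)) :
    Derivable E R t (t.subst fun x => .var (f x)) := by
  induction t with
  | var x => exact .hyp (hf x rfl)
  | star => exact .refl _
  | oplus s t hs ht =>
    exact .oplus (hs fun x hx => hf x (Or.inl hx)) (ht fun x hx => hf x (Or.inr hx))
  | pplus p s t hs ht =>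
    exact .pplus p (hs fun x hx => hf x (Or.inl hx)) (ht fun x hx => hf x (Or.inr hx))

/-! ### Provable equality of processes and induction on action depth. -/

section ProofSystem

variable {A : Type u} {E : Equations}

/-- The nesting depth of actions in a process term. -/
def Proc.depth : Proc A → ℕ
  | nil => 0
  | act _ P => P.depth + 1
  | oplus P Q => max P.depth Q.depth
  | pplus _ P Q => max P.depth Q.depth

/-- Generators enter a transition term only through prefixes `a.P`, each of which adds one to the
depth. -/
theorem Proc.depth_lt_of_mem_vars_step {P P' : Proc A} (h : P' ∈ P.step.vars) :
    P'.depth < P.depth := by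
  induction P with
  | nil => exact h.elim
  | act a P =>
    obtain rfl : P' = P := h
    exact Nat.lt_succ_self _
  | oplus P Q hP hQ => exact lt_max_iff.2 (h.imp hP hQ)
  | pplus p P Q hP hQ => exact lt_max_iff.2 (h.imp hP hQ)

/-- Derivability is monotone in its premises, so any set of proved premises can be enlarged to all
of provable equality. -/
theorem provablyEq_iff {P Q : Proc A} :
    ProvablyEq E P Q ↔ Derivable E (ProvablyEq E) P.step Q.step :=
  ⟨fun ⟨_, hR, h⟩ => h.mono hR, .rule _ fun _ _ => id⟩

variable (A E) in
/-- The relation defined by the proof system is an equivalence relation. -/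
def provablyEqSetoid : Setoid (Proc A) where
  r := ProvablyEq E
  iseqv := by
    refine ⟨fun P => ?_, fun h => ?_, fun h h' => ?_⟩
    · exact provablyEq_iff.2 (.refl _)
    · exact provablyEq_iff.2 (provablyEq_iff.1 h).symm
    · exact provablyEq_iff.2 ((provablyEq_iff.1 h).trans (provablyEq_iff.1 h'))

/-- Transitions of provably equal processes are identified in every model over the quotient. -/
theorem ProvablyEq.eval_eq {P Q : Proc A} (h : ProvablyEq E P Q) {α : Type v} {𝔸 : Alg α}
    (h𝔸 : 𝔸.Models E) (η : Quotient (provablyEqSetoid A E) → α) :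
    (P.step.subst fun x => .var (Quotient.mk (provablyEqSetoid A E) x)).eval 𝔸 η =
      (Q.step.subst fun x => .var (Quotient.mk (provablyEqSetoid A E) x)).eval 𝔸 η := by
  rw [Term.eval_subst, Term.eval_subst]
  exact (provablyEq_iff.1 h).eval_eq h𝔸 fun x y hxy => congrArg η (Quotient.sound hxy)

/-- A relation is contained in provable equality if the transitions of related processes are
identified in every model over the quotient. -/
theorem provablyEq_of_eval_eq (R : Setoid (Proc A))
    (hR : ∀ P Q, R P Q → ∀ (α : Type u) (𝔸 : Alg α), 𝔸.Models E → ∀ η : Quotient R → α,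
      (P.step.subst fun x => .var (Quotient.mk R x)).eval 𝔸 η =
        (Q.step.subst fun x => .var (Quotient.mk R x)).eval 𝔸 η)
    {P Q : Proc A} (h : R P Q) : ProvablyEq E P Q := by
  classical
  obtain ⟨n, hP, hQ⟩ : ∃ n, P.depth < n ∧ Q.depth < n :=
    ⟨max P.depth Q.depth + 1, by omega, by omega⟩
  induction n generalizing P Q with
  | zero => exact absurd hP (Nat.not_lt_zero _)
  | succ n ih =>
  -- The induction hypothesis compares only processes of depth below `n`, so an arbitrary
  -- representative would not do: one of depth below `n` is chosen whenever the class has one. The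
  -- value on other classes plays no role.
  let rep : Quotient R → Proc A := fun c =>
    if hc : ∃ x, x.depth < n ∧ Quotient.mk R x = c then hc.choose else c.out
  have hrep (x : Proc A) (hx : x.depth < n) : ProvablyEq E x (rep (Quotient.mk R x)) := by
    have hc : ∃ y, y.depth < n ∧ Quotient.mk R y = Quotient.mk R x := ⟨x, hx, rfl⟩
    have hr : rep (Quotient.mk R x) = hc.choose := dif_pos hc
    rw [hr]
    exact ih (R.symm (Quotient.exact hc.choose_spec.2)) hx hc.choose_spec.1
  -- In the term model over provable equality, agreement of values is derivability of an equation
  -- between the transition terms with generators replaced by representatives.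
  have e := hR P Q h _ _ (derivableAlg_models E (ProvablyEq (A := A) E))
    fun c => Quotient.mk _ (.var (rep c))
  rw [Term.eval_subst, Term.eval_subst] at e
  simp only [Term.eval] at e
  rw [eval_derivableAlg E _ fun x => .var (rep (Quotient.mk R x)),
    eval_derivableAlg E _ fun x => .var (rep (Quotient.mk R x))] at e
  have d : Derivable E (ProvablyEq E) _ _ := Quotient.exact e
  -- Generators of `T.step` have depth below `n`, so replacing them by their representatives is
  -- derivable.
  have hsub (T : Proc A) (hT : T.depth < n + 1) : Derivable E (ProvablyEq E) T.step
      (T.step.subst fun x => .var (rep (Quotient.mk R x))) :=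
    Derivable.subst_var fun x hx => hrep x (by
      have := Proc.depth_lt_of_mem_vars_step hx
      omega)
  exact provablyEq_iff.2 (((hsub P hP).trans d).trans (hsub Q hQ).symm)

end ProofSystem

end NDProb

/-! ### The three equivalences. -/

theorem mainTheorem11 (A : Type u) (P Q : NDProb.Proc A) :
    (NDProb.ProvablyEq NDProb.pointedCS P Q ↔
      NDProb.BehaviourallyEquivalent (NDProb.procConvPlusOne A) P Q) ∧
    (NDProb.ProvablyEq NDProb.bottomBlackHoleCS P Q ↔
      NDProb.BehaviourallyEquivalent (NDProb.procPlusOneConv A) P Q) ∧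
    (NDProb.ProvablyEq NDProb.bottomCS P Q ↔
      NDProb.BehaviourallyEquivalent (NDProb.procConvDown A) P Q) := by
  refine ⟨⟨fun h => ?_, fun ⟨R, hR, h⟩ => ?_⟩, ⟨fun h => ?_, fun ⟨R, hR, h⟩ => ?_⟩,
    ⟨fun h => ?_, fun ⟨R, hR, h⟩ => ?_⟩⟩
  -- Provable equality itself is the behavioural equivalence; naturality on both sides reduces the
  -- condition to soundness in the algebra over the quotient.
  · refine ⟨NDProb.provablyEqSetoid A _, fun P Q h => ?_, h⟩
    exact (NDProb.convPlusOne_map_eval _ P.step).trans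
      ((NDProb.ProvablyEq.eval_eq h (NDProb.convPlusOneAlg_models _) _).trans
        (NDProb.convPlusOne_map_eval _ Q.step).symm)
  -- By naturality, the condition on `R` is equality of the renamed transition terms in the monad's
  -- algebra, and completeness carries it to every model.
  · refine NDProb.provablyEq_of_eval_eq R (fun P Q h α 𝔸 h𝔸 η => ?_) h
    exact NDProb.Term.eval_eq_of_convPlusOne h𝔸 η
      ((NDProb.convPlusOne_map_eval _ P.step).symm.trans
        ((hR P Q h).trans (NDProb.convPlusOne_map_eval _ Q.step)))
  · refine ⟨NDProb.provablyEqSetoid A _, fun P Q h => ?_, h⟩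
    exact (NDProb.plusOneConv_map_eval _ P.step).trans
      ((NDProb.ProvablyEq.eval_eq h (NDProb.plusOneConvAlg_models _) _).trans
        (NDProb.plusOneConv_map_eval _ Q.step).symm)
  · refine NDProb.provablyEq_of_eval_eq R (fun P Q h α 𝔸 h𝔸 η => ?_) h
    exact NDProb.Term.eval_eq_of_plusOneConv h𝔸 η
      ((NDProb.plusOneConv_map_eval _ P.step).symm.trans
        ((hR P Q h).trans (NDProb.plusOneConv_map_eval _ Q.step)))
  · refine ⟨NDProb.provablyEqSetoid A _, fun P Q h => ?_, h⟩
    exact (NDProb.convDown_map_eval _ P.step).trans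
      ((NDProb.ProvablyEq.eval_eq h (NDProb.convDownAlg_models _) _).trans
        (NDProb.convDown_map_eval _ Q.step).symm)
  · refine NDProb.provablyEq_of_eval_eq R (fun P Q h α 𝔸 h𝔸 η => ?_) h
    exact NDProb.Term.eval_eq_of_convDown h𝔸 η
      ((NDProb.convDown_map_eval _ P.step).symm.trans
        ((hR P Q h).trans (NDProb.convDown_map_eval _ Q.step)))
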